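/- **Censored lower bound.** Fix a number of arms $K$, a window $m\in\mathbb N$ and a probability law on $\mathbb N$ for the delays, with CDF $\tau_d=\mathbb P(D\le d)$ and $\tau_m>0$. For $\theta\in[0,1]^K$ consider the following bandit model. At each round $t=1,2,\dots$ the learner plays an arm $A_t\in\{1,\dots,K\}$, which triggers a conversion indicator $C_t\sim\mathrm{Bernoulli}(\theta_{A_t})$ and a delay $D_t$ with CDF $\tau$, independent of each other and of the past. Put $X_{s,u}=C_s\mathbf 1\{D_s\le u-s\}$ for $s\le u$. The learner chooses $A_t$ as a measurable function (the same for all $\theta$) of the observations $(X_{s,u})_{1\le u\le t-1,\ \max(1,u-m)\le s\le u}$ and, possibly, of a private random seed independent of everything else. The reward of round $t$ is $Y_t=\sum_{s=\max(1,t-m)}^{t}C_s\mathbf 1\{D_s=t-s\}$, and the (expected) regret $R(T)$ is the expectation of $\sum_{t=1}^T Y_t$ for the oracle that always plays an arm of maximal parameter, minus the expectation of $\sum_{t=1}^T Y_t$ for the learner. An algorithm is *uniformly efficient* if, for every $\theta\in[0,1]^K$ and every $\alpha\in(0,1)$, $R(T)/T^\alpha\to0$ as $T\to\infty$; the algorithm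 may depend on $K$, $m$ and the delay law. Let $\theta\in[0,1]^K$ have a unique optimal arm $k^*$, with $\theta^*:=\theta_{k^*}<1$. Then every uniformly efficient algorithm satisfies, in the model with parameter $\theta$, $$\liminf_{T\to\infty}\frac{R(T)}{\log T}\ \ge\ \sum_{k\ne k^*}\frac{\tau_m(\theta^*-\theta_k)}{d(\tau_m\theta_k,\tau_m\theta^*)},$$ where $d(p,q)=p\log\frac pq+(1-p)\log\frac{1-p}{1-q}$ (with $0\log0=0$) is the Kullback–Leibler divergence between the Bernoulli laws of parameters $p$ and $q$, and the $\liminf$ is taken in $[-\infty,+\infty]$. -/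

import Mathlib

open MeasureTheory ProbabilityTheory Filter Topology

namespace CensoredBandit

/-- The pairs `(s, u)` of rounds for which the contribution `X_{s,u}` has been shown to the learner
before the decision of round `t` in the model with window `m`: `1 ≤ s ≤ u ≤ t - 1` and
`u - m ≤ s`. Rounds are numbered `1, 2, 3, …`. -/
abbrev ObsIndex (m t : ℕ) : Type :=
  {p : ℕ × ℕ // 1 ≤ p.1 ∧ p.1 ≤ p.2 ∧ p.2 < t ∧ p.2 ≤ p.1 + m}

/-- The possible values of the history `(X_{s,u})` available when the arm of round `t` is chosen
(`true` stands for `1`, `false` for `0`). -/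
abbrev History (m t : ℕ) : Type := ObsIndex m t → Bool

/-- A (possibly randomized) bandit algorithm with `K` arms for the model with window `m`: the arm
of round `t` is a measurable function of a private random seed and of the history. Deterministic
algorithms are those that ignore the seed. -/
structure Policy (K m : ℕ) (Seed : Type*) [MeasurableSpace Seed] where
  choose : (t : ℕ) → Seed → History m t → Fin K
  measurable_choose : ∀ t, Measurable fun p : Seed × History m t => choose t p.1 p.2

/-- The algorithm that always plays the arm `a`. -/
def Policy.const {K m : ℕ} {Seed : Type*} [MeasurableSpace Seed] (a : Fin K) :
    Policy K m Seed where
  choose _ _ _ := a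
  measurable_choose _ := measurable_const

/-- A sample point: the seed of the learner and, for every round `s`, the conversion indicators
that the `K` arms would yield at round `s` together with the delay `D_s`. -/
abbrev Sample (K : ℕ) (Seed : Type*) : Type _ := Seed × (ℕ → (Fin K → Bool) × ℕ)

/-- The law of the sample point: all coordinates are independent, the seed has law `ν`, the
conversion indicator of arm `k` is Bernoulli with parameter `θ k` and the delays have law `δ`. -/
noncomputable def sampleLaw {K : ℕ} {Seed : Type*} [MeasurableSpace Seed] (ν : Measure Seed)
    (δ : Measure ℕ) [IsProbabilityMeasure δ] (θ : Fin K → unitInterval) :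
    Measure (Sample K Seed) :=
  ν.prod (Measure.infinitePi fun _ : ℕ =>
    (Measure.pi fun k => bernoulliMeasure true false (θ k)).prod δ)

/-- The delay `D_s` of round `s`. -/
def delay {K : ℕ} {Seed : Type*} (ω : Sample K Seed) (s : ℕ) : ℕ := (ω.2 s).2

section Model

variable {K m : ℕ} {Seed : Type*} [MeasurableSpace Seed]

/-- The arm `A_t` played at round `t`: the choice of the algorithm given its seed and the history
formed by the contributions `X_{s,u} = C_s 1{D_s ≤ u - s}`, where `C_s` is the conversion
indicator of the arm `A_s`. -/
def action (π : Policy K m Seed) (ω : Sample K Seed) (t : ℕ) : Fin K :=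
  π.choose t ω.1 fun p =>
    have : p.1.1 < t := lt_of_le_of_lt p.2.2.1 p.2.2.2.1
    (ω.2 p.1.1).1 (action π ω p.1.1) && decide (delay ω p.1.1 ≤ p.1.2 - p.1.1)
termination_by t

/-- The conversion indicator `C_t ∈ {0, 1}` of the action of round `t`. -/
def conversion (π : Policy K m Seed) (ω : Sample K Seed) (t : ℕ) : Bool :=
  (ω.2 t).1 (action π ω t)

/-- The reward `Y_t = ∑_{s = t - m}^{t} C_s 1{D_s = t - s}` of round `t`: the number of
conversions disclosed at round `t` (the sum is over the rounds `s ≥ 1`). -/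
def reward (π : Policy K m Seed) (ω : Sample K Seed) (t : ℕ) : ℝ :=
  ∑ s ∈ Finset.Icc 1 t with t ≤ s + m,
    if conversion π ω s = true ∧ delay ω s = t - s then 1 else 0

/-- The expected cumulated reward `E_θ[r(T)] = E_θ[∑_{t=1}^T Y_t]`. -/
noncomputable def expectedReward (ν : Measure Seed) (δ : Measure ℕ) [IsProbabilityMeasure δ]
    (θ : Fin K → unitInterval) (π : Policy K m Seed) (T : ℕ) : ℝ :=
  ∫ ω, ∑ t ∈ Finset.Icc 1 T, reward π ω t ∂(sampleLaw ν δ θ)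

/-- The expected regret at horizon `T` with respect to the oracle that always plays the arm `a`
(used only when `a` is an optimal arm of `θ`). -/
noncomputable def regret (ν : Measure Seed) (δ : Measure ℕ) [IsProbabilityMeasure δ]
    (θ : Fin K → unitInterval) (a : Fin K) (π : Policy K m Seed) (T : ℕ) : ℝ :=
  expectedReward ν δ θ (Policy.const a : Policy K m Seed) T - expectedReward ν δ θ π T

/-- Uniform efficiency: for every bandit model `θ ∈ [0, 1]^K` and every `α ∈ (0, 1)`, the expected
regret is `o(T ^ α)`. The window and the delay distribution are fixed and may be known to the
algorithm. -/
def UniformlyEfficient (ν : Measure Seed) (δ : Measure ℕ) [IsProbabilityMeasure δ]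
    (π : Policy K m Seed) : Prop :=
  ∀ (θ : Fin K → unitInterval) (a : Fin K), (∀ k, θ k ≤ θ a) →
    ∀ α : ℝ, 0 < α → α < 1 →
      Tendsto (fun T : ℕ => regret ν δ θ a π T / (T : ℝ) ^ α) atTop (𝓝 0)

end Model

/-- The cumulative distribution function `τ_d = P(D ≤ d)` of the delay law `δ`. -/
noncomputable def delayCDF (δ : Measure ℕ) (d : ℕ) : ℝ := δ.real (Set.Iic d)

/-- The Kullback-Leibler divergence between the Bernoulli laws of parameters `p` and `q`, for
`p ∈ [0, 1]` and `q ∈ (0, 1)` (with `0 log 0 = 0`). -/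
noncomputable def bernoulliKL (p q : ℝ) : ℝ :=
  p * Real.log (p / q) + (1 - p) * Real.log ((1 - p) / (1 - q))

end CensoredBandit

/-!
The regret at horizon `T + m` is at least `τ_m * ∑ k, (θ* - θ k) * E[N_k(T)]`, where `N_k(T)` counts
the rounds `s ≤ T` in which the arm `k` is played (`le_regret`): the conversions that the arms
would yield at round `s` and its delay are independent of the action of that round, and a round
`s ≤ T` has disclosed its whole window at time `T + m`. It remains to bound `E[N_k(T)]` from below for each suboptimal arm `k`.

Everything the learner ever sees of round `s` is a function of its `observation`, which is the delay
of the conversion if this delay is at most `m`, and "nothing" otherwise. Let `θ'` differ from `θ`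
only in the parameter of `k`. Then the log-likelihood ratio of the seed and the first `T`
observations is a sum of terms for the rounds in which `k` is played, each of conditional mean
`d(τ_m θ k, τ_m θ' k)`; its expectation under `θ` is this divergence times `E_θ[N_k(T)]`. The change
of measure (`integral_mul_exp_le`) is proved by induction on `T`: round `T + 1` is independent of
the past, so it can be resampled (`integral_resample`) and integrated out. Together with Jensen's
inequality it gives the inequality of Donsker and Varadhan, and hence, for every real `a`,
`a * E_θ[W] - E_θ[N_k(T)] * d(τ_m θ k, τ_m θ' k) ≤ log (1 + (exp a - 1) * E_θ'[W])`
with `W = 1 - N_k(T) / T` (`information_inequality`).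

Take `θ' k` slightly above `θ*` and `exp a = 1 + T ^ β` with `β < 1`. By uniform efficiency under
`θ`, `E_θ[W]` tends to `1`; by uniform efficiency under `θ'`, where `k` is the best arm,
`T ^ β * E_θ'[W]` tends to `0`. So `E_θ[N_k(T)]` is asymptotically at least
`β * log T / d(τ_m θ k, τ_m θ' k)`, and the bound follows as `β` tends to `1` and `θ' k` to `θ*`
(`UniformlyEfficient.eventually_le_meanPulls`).
-/

namespace CensoredBandit

/-! ### Resampling one round -/

/-- The law of the potential outcomes of one round: the conversion indicators that the arms would
yield, and the delay. -/
noncomputable def roundLaw {K : ℕ} (δ : Measure ℕ) (θ : Fin K → unitInterval) :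
    Measure ((Fin K → Bool) × ℕ) :=
  (Measure.pi fun k => bernoulliMeasure true false (θ k)).prod δ

/-- The sample point `ω` with the potential outcomes of round `t` replaced by `e`. -/
def resample {K : ℕ} {Seed : Type*} (ω : Sample K Seed) (t : ℕ) (e : (Fin K → Bool) × ℕ) :
    Sample K Seed :=
  (ω.1, Function.update ω.2 t e)

instance {K : ℕ} (δ : Measure ℕ) [IsProbabilityMeasure δ] (θ : Fin K → unitInterval) :
    IsProbabilityMeasure (roundLaw δ θ) := by
  unfold roundLaw; infer_instance

lemma sampleLaw_eq {K : ℕ} {Seed : Type*} [MeasurableSpace Seed] (ν : Measure Seed)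
    (δ : Measure ℕ) [IsProbabilityMeasure δ] (θ : Fin K → unitInterval) :
    sampleLaw ν δ θ = ν.prod (Measure.infinitePi fun _ : ℕ => roundLaw δ θ) := rfl

instance {K : ℕ} {Seed : Type*} [MeasurableSpace Seed] (ν : Measure Seed)
    [IsProbabilityMeasure ν] (δ : Measure ℕ) [IsProbabilityMeasure δ] (θ : Fin K → unitInterval) :
    IsProbabilityMeasure (sampleLaw ν δ θ) := by
  rw [sampleLaw_eq]; infer_instance

lemma measurable_update_prod {E : Type*} [MeasurableSpace E] (i : ℕ) :
    Measurable fun p : (ℕ → E) × E => Function.update p.1 i p.2 := by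
  refine measurable_pi_lambda _ fun j => ?_
  by_cases h : j = i
  · subst h; simpa using measurable_snd
  · simp only [Function.update_of_ne h]; fun_prop

/-- Replacing one coordinate of an i.i.d. sequence by a fresh independent copy does not change the
law of the sequence. -/
lemma map_update_infinitePi {E : Type*} [MeasurableSpace E] (μ : Measure E)
    [IsProbabilityMeasure μ] (i : ℕ) :
    ((Measure.infinitePi fun _ : ℕ => μ).prod μ).map (fun p => Function.update p.1 i p.2) =
      Measure.infinitePi fun _ : ℕ => μ := by
  have hmeas := measurable_update_prod (E := E) i
  refine Measure.eq_infinitePi _ fun s t ht => ?_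
  rw [Measure.map_apply hmeas (MeasurableSet.pi s.countable_toSet fun j _ => ht j)]
  by_cases hi : i ∈ s
  · have : (fun p : (ℕ → E) × E => Function.update p.1 i p.2) ⁻¹' (Set.pi s t) =
        (Set.pi (s.erase i : Finset ℕ) t) ×ˢ t i := by
      ext p
      simp only [Set.mem_preimage, Set.mem_pi, Set.mem_prod, Finset.mem_coe, Finset.mem_erase]
      constructor
      · intro h
        refine ⟨fun j hj => ?_, ?_⟩
        · have := h j hj.2
          rwa [Function.update_of_ne hj.1] at this
        · have := h i hi
          rwa [Function.update_self] at this
      · rintro ⟨h1, h2⟩ j hj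
        by_cases hji : j = i
        · subst hji; rwa [Function.update_self]
        · rw [Function.update_of_ne hji]; exact h1 j ⟨hji, hj⟩
    rw [this, Measure.prod_prod, Measure.infinitePi_pi _ fun j _ => ht j,
      Finset.prod_erase_mul _ _ hi]
  · have : (fun p : (ℕ → E) × E => Function.update p.1 i p.2) ⁻¹' (Set.pi s t) =
        (Set.pi s t) ×ˢ Set.univ := by
      ext p
      simp only [Set.mem_preimage, Set.mem_pi, Set.mem_prod, Finset.mem_coe, Set.mem_univ,
        and_true]
      refine forall₂_congr fun j hj => ?_
      rw [Function.update_of_ne (by rintro rfl; exact hi hj)]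
    rw [this, Measure.prod_prod, Measure.infinitePi_pi _ fun j _ => ht j, measure_univ, mul_one]

variable {K m : ℕ} {Seed : Type*} [MeasurableSpace Seed]

lemma measurable_resample (t : ℕ) :
    Measurable fun p : Sample K Seed × ((Fin K → Bool) × ℕ) => resample p.1 t p.2 := by
  exact Measurable.prodMk (by fun_prop)
    ((measurable_update_prod t).comp (by fun_prop : Measurable fun p :
      Sample K Seed × ((Fin K → Bool) × ℕ) => (p.1.2, p.2)))

/-- A bounded measurable function is integrable for every probability measure. -/
lemma integrable_of_abs_le {Ω : Type*} [MeasurableSpace Ω] {P : Measure Ω}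
    [IsProbabilityMeasure P] {f : Ω → ℝ} (hf : Measurable f) {B : ℝ} (hB : ∀ ω, |f ω| ≤ B) :
    Integrable f P :=
  Integrable.of_bound hf.aestronglyMeasurable B (ae_of_all _ hB)

lemma integral_resample (ν : Measure Seed) [IsProbabilityMeasure ν] (δ : Measure ℕ)
    [IsProbabilityMeasure δ] (θ : Fin K → unitInterval) (t : ℕ) {Φ : Sample K Seed → ℝ}
    (hΦ : Measurable Φ) {B : ℝ} (hB : ∀ ω, |Φ ω| ≤ B) :
    ∫ ω, Φ ω ∂(sampleLaw ν δ θ) =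
      ∫ ω, ∫ e, Φ (resample ω t e) ∂(roundLaw δ θ) ∂(sampleLaw ν δ θ) := by
  have hmeas := measurable_update_prod (E := (Fin K → Bool) × ℕ) t
  have hint : Measurable fun ω => ∫ e, Φ (resample ω t e) ∂(roundLaw δ θ) :=
    ((hΦ.comp (measurable_resample t)).stronglyMeasurable.integral_prod_right').measurable
  have hintB : ∀ ω, |∫ e, Φ (resample ω t e) ∂(roundLaw δ θ)| ≤ B := fun ω => by
    have := norm_integral_le_of_norm_le_const (μ := roundLaw δ θ)
      (f := fun e => Φ (resample ω t e)) (ae_of_all _ fun e => hB _)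
    simpa using this
  rw [sampleLaw_eq, integral_prod _ (integrable_of_abs_le hΦ hB),
    integral_prod _ (integrable_of_abs_le hint hintB)]
  refine integral_congr_ae (ae_of_all _ fun u => ?_)
  have hu : Measurable fun x => Φ (u, x) := hΦ.comp measurable_prodMk_left
  simp only
  conv_lhs => rw [← map_update_infinitePi (roundLaw δ θ) t]
  rw [integral_map hmeas.aemeasurable hu.aestronglyMeasurable,
    integral_prod (fun p : (ℕ → (Fin K → Bool) × ℕ) × ((Fin K → Bool) × ℕ) =>
      Φ (u, Function.update p.1 t p.2))
      (integrable_of_abs_le (hu.comp hmeas) fun _ => hB _)]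
  rfl

/-! ### Observations -/

/-- What the window `m` shows of a round with conversion indicator `c` and delay `d`: the delay of
the conversion if it is disclosed, and `m + 1` if nothing is disclosed. -/
def outcome (m : ℕ) (c : Bool) (d : ℕ) : ℕ := if c = true ∧ d ≤ m then d else m + 1

/-- The outcome of round `s` as the learner sees it after `m` further rounds. -/
def observation (π : Policy K m Seed) (ω : Sample K Seed) (s : ℕ) : ℕ :=
  outcome m (conversion π ω s) (delay ω s)

lemma outcome_le (m : ℕ) (c : Bool) (d : ℕ) : outcome m c d ≤ m + 1 := by
  unfold outcome; split_ifs <;> omega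

lemma outcome_le_iff {m j : ℕ} (hj : j ≤ m) (c : Bool) (d : ℕ) :
    outcome m c d ≤ j ↔ c = true ∧ d ≤ j := by
  unfold outcome; split_ifs with h
  · simp [h.1]
  · constructor
    · intro; omega
    · rintro ⟨h1, h2⟩; exact absurd ⟨h1, h2.trans hj⟩ h

lemma action_eq (π : Policy K m Seed) (ω : Sample K Seed) (t : ℕ) :
    action π ω t = π.choose t ω.1 fun p => decide (observation π ω p.1.1 ≤ p.1.2 - p.1.1) := by
  rw [action]
  congr 1
  funext p
  obtain ⟨⟨s, u⟩, h⟩ := p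
  have key := outcome_le_iff (m := m) (j := u - s) (by simp only at h; omega)
    (conversion π ω s) (delay ω s)
  rw [Bool.eq_iff_iff, Bool.and_eq_true, decide_eq_true_eq, decide_eq_true_eq]
  exact key.symm

/-- The actions are a function of the seed and of the earlier observations. -/
lemma action_congr (π : Policy K m Seed) {ω ω' : Sample K Seed} {t : ℕ} (h1 : ω.1 = ω'.1)
    (h : ∀ s ∈ Finset.Ico 1 t, observation π ω s = observation π ω' s) :
    action π ω t = action π ω' t := by
  rw [action_eq, action_eq, h1]
  congr 1
  funext p
  rw [h p.1.1 (Finset.mem_Ico.2 ⟨p.2.1, lt_of_le_of_lt p.2.2.1 p.2.2.2.1⟩)]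

lemma action_resample (π : Policy K m Seed) (ω : Sample K Seed) (t : ℕ)
    (e : (Fin K → Bool) × ℕ) : ∀ s ≤ t, action π (resample ω t e) s = action π ω s := by
  intro s
  induction s using Nat.strong_induction_on with
  | _ s ih =>
    intro hs
    refine action_congr π rfl fun r hr => ?_
    have hr' := (Finset.mem_Ico.1 hr).2
    have hrt : r ≠ t := by omega
    simp only [observation, conversion, delay, ih r hr' (by omega)]
    simp [resample, Function.update_of_ne hrt]

lemma observation_resample_of_lt (π : Policy K m Seed) (ω : Sample K Seed) {s t : ℕ}
    (e : (Fin K → Bool) × ℕ) (h : s < t) :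
    observation π (resample ω t e) s = observation π ω s := by
  simp only [observation, conversion, delay, action_resample π ω t e s h.le]
  simp [resample, Function.update_of_ne h.ne]

lemma conversion_resample_self (π : Policy K m Seed) (ω : Sample K Seed) (t : ℕ)
    (e : (Fin K → Bool) × ℕ) : conversion π (resample ω t e) t = e.1 (action π ω t) := by
  simp only [conversion, action_resample π ω t e t le_rfl]
  simp [resample]

omit [MeasurableSpace Seed] in
lemma delay_resample_self (ω : Sample K Seed) (t : ℕ) (e : (Fin K → Bool) × ℕ) :
    delay (resample ω t e) t = e.2 := by
  simp [delay, resample]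

lemma observation_resample_self (π : Policy K m Seed) (ω : Sample K Seed) (t : ℕ)
    (e : (Fin K → Bool) × ℕ) :
    observation π (resample ω t e) t = outcome m (e.1 (action π ω t)) e.2 := by
  rw [observation, conversion_resample_self, delay_resample_self]

lemma measurable_round (s : ℕ) : Measurable fun ω : Sample K Seed => ω.2 s :=
  (measurable_pi_apply s).comp measurable_snd

lemma measurable_action (π : Policy K m Seed) (t : ℕ) :
    Measurable fun ω : Sample K Seed => action π ω t := by
  induction t using Nat.strong_induction_on with
  | _ t ih =>
    simp_rw [action_eq]
    refine (π.measurable_choose t).comp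
      (measurable_fst.prodMk (measurable_pi_lambda _ fun p => ?_))
    have hp : p.1.1 < t := lt_of_le_of_lt p.2.2.1 p.2.2.2.1
    have hd : Measurable fun q : ((Fin K → Bool) × ℕ) × Fin K =>
        decide (outcome m (q.1.1 q.2) q.1.2 ≤ p.1.2 - p.1.1) := Measurable.of_discrete
    exact hd.comp ((measurable_round p.1.1).prodMk (ih _ hp))

lemma measurable_conversion (π : Policy K m Seed) (t : ℕ) :
    Measurable fun ω : Sample K Seed => conversion π ω t := by
  have hd : Measurable fun q : ((Fin K → Bool) × ℕ) × Fin K => q.1.1 q.2 := Measurable.of_discrete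
  exact hd.comp ((measurable_round t).prodMk (measurable_action π t))

lemma measurable_delay (t : ℕ) : Measurable fun ω : Sample K Seed => delay ω t :=
  measurable_snd.comp (measurable_round t)

lemma measurable_observation (π : Policy K m Seed) (t : ℕ) :
    Measurable fun ω : Sample K Seed => observation π ω t := by
  have hd : Measurable fun q : Bool × ℕ => outcome m q.1 q.2 := Measurable.of_discrete
  exact hd.comp ((measurable_conversion π t).prodMk (measurable_delay t))

/-! ### The law of one observation -/

/-- An observation of arm `a` is `d ≤ m` with probability `θ a * δ {d}`, and `m + 1` with the
remaining probability `1 - τ_m * θ a`. -/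
lemma integral_outcome (δ : Measure ℕ) [IsProbabilityMeasure δ] (θ : Fin K → unitInterval)
    (a : Fin K) (j : ℕ) (f : ℕ → ℝ) :
    ∫ e, f (outcome j (e.1 a) e.2) ∂(roundLaw δ θ) =
      (θ a : ℝ) * ∫ d in Set.Iic j, f d ∂δ + (1 - delayCDF δ j * θ a) * f (j + 1) := by
  have hB : ∀ c d, |f (outcome j c d)| ≤ ∑ i ∈ Finset.range (j + 2), |f i| := fun c d =>
    Finset.single_le_sum (f := fun i => |f i|) (fun i _ => abs_nonneg _)
      (Finset.mem_range.2 (by have := outcome_le j c d; omega))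
  have h1 : ∫ d, f (outcome j true d) ∂δ =
      ∫ d in Set.Iic j, f d ∂δ + (1 - delayCDF δ j) * f (j + 1) := by
    have hint : Integrable (fun d => f (outcome j true d)) δ :=
      integrable_of_abs_le Measurable.of_discrete fun d => hB true d
    rw [← integral_add_compl (measurableSet_Iic (a := j)) hint]
    congr 1
    · refine setIntegral_congr_fun measurableSet_Iic fun d hd => ?_
      rw [outcome, if_pos ⟨rfl, hd⟩]
    · rw [setIntegral_congr_fun (g := fun _ => f (j + 1)) measurableSet_Iic.compl fun d hd => ?_]
      · rw [setIntegral_const, measureReal_compl measurableSet_Iic]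
        simp [delayCDF]
      · rw [outcome, if_neg fun h => hd h.2]
  have h2 : ∫ d, f (outcome j false d) ∂δ = f (j + 1) := by simp [outcome]
  rw [roundLaw, integral_prod _ (integrable_of_abs_le Measurable.of_discrete fun e => hB _ _)]
  have hmp := measurePreserving_eval (fun k => bernoulliMeasure true false (θ k)) a
  have h3 : ∫ x : Fin K → Bool, ∫ d, f (outcome j (x a) d) ∂δ
      ∂(Measure.pi fun k => bernoulliMeasure true false (θ k)) =
      ∫ c, ∫ d, f (outcome j c d) ∂δ ∂(bernoulliMeasure true false (θ a)) := by
    rw [← hmp.map_eq, integral_map hmp.measurable.aemeasurable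
      (Measurable.of_discrete).aestronglyMeasurable]
  rw [h3, integral_bernoulliMeasure, h1, h2]
  simp only [smul_eq_mul]
  ring

/-! ### Regret and numbers of pulls -/

/-- The probability that the algorithm plays the arm `k` at round `s`. -/
noncomputable def playProb (ν : Measure Seed) (δ : Measure ℕ) [IsProbabilityMeasure δ]
    (θ : Fin K → unitInterval) (π : Policy K m Seed) (k : Fin K) (s : ℕ) : ℝ :=
  (sampleLaw ν δ θ).real {ω | action π ω s = k}

/-- The expected number of times the arm `k` is played during the rounds `1, …, T`. -/
noncomputable def meanPulls (ν : Measure Seed) (δ : Measure ℕ) [IsProbabilityMeasure δ]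
    (θ : Fin K → unitInterval) (π : Policy K m Seed) (k : Fin K) (T : ℕ) : ℝ :=
  ∑ s ∈ Finset.Icc 1 T, playProb ν δ θ π k s

section Regret

variable (ν : Measure Seed) [IsProbabilityMeasure ν] (δ : Measure ℕ) [IsProbabilityMeasure δ]
  (θ : Fin K → unitInterval) (π : Policy K m Seed)

omit [IsProbabilityMeasure ν] in
lemma integral_ite_action (k : Fin K) (s : ℕ) (c : ℝ) :
    ∫ ω, (if action π ω s = k then c else 0) ∂(sampleLaw ν δ θ) = playProb ν δ θ π k s * c := by
  have hm : MeasurableSet {ω : Sample K Seed | action π ω s = k} :=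
    measurable_action π s (measurableSet_singleton k)
  have : (fun ω : Sample K Seed => if action π ω s = k then c else 0) =
      {ω | action π ω s = k}.indicator fun _ => c := by
    ext ω; simp [Set.indicator]
  rw [this, integral_indicator_const _ hm, smul_eq_mul, playProb]

lemma integral_comp_action (g : Fin K → ℝ) (s : ℕ) :
    ∫ ω, g (action π ω s) ∂(sampleLaw ν δ θ) = ∑ k, playProb ν δ θ π k s * g k := by
  have : (fun ω : Sample K Seed => g (action π ω s)) =
      fun ω => ∑ k, if action π ω s = k then g k else 0 := by
    ext ω; simp
  rw [this, integral_finsetSum]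
  · exact Finset.sum_congr rfl fun k _ => integral_ite_action ν δ θ π k s (g k)
  · intro k _
    refine integrable_of_abs_le (B := |g k|) ?_ fun ω => ?_
    · exact Measurable.ite (measurable_action π s (measurableSet_singleton k))
        measurable_const measurable_const
    · split_ifs <;> simp

omit [IsProbabilityMeasure ν] in
lemma playProb_nonneg (k : Fin K) (s : ℕ) : 0 ≤ playProb ν δ θ π k s := measureReal_nonneg

lemma sum_playProb (s : ℕ) : ∑ k, playProb ν δ θ π k s = 1 := by
  have := integral_comp_action ν δ θ π (fun _ => 1) s
  simpa using this.symm

omit [IsProbabilityMeasure ν] in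
lemma meanPulls_nonneg (k : Fin K) (T : ℕ) : 0 ≤ meanPulls ν δ θ π k T :=
  Finset.sum_nonneg fun s _ => playProb_nonneg ν δ θ π k s

lemma sum_meanPulls (T : ℕ) : ∑ k, meanPulls ν δ θ π k T = T := by
  simp only [meanPulls]
  rw [Finset.sum_comm]
  simp [sum_playProb]

/-- Within the first `T` rounds, the round `s` yields its reward exactly if its conversion takes
place with a delay of at most `min m (T - s)`. -/
lemma sum_reward (ω : Sample K Seed) (T : ℕ) :
    ∑ t ∈ Finset.Icc 1 T, reward π ω t =
      ∑ s ∈ Finset.Icc 1 T,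
        if conversion π ω s = true ∧ delay ω s ≤ min m (T - s) then (1 : ℝ) else 0 := by
  simp only [reward]
  rw [Finset.sum_comm' (t' := Finset.Icc 1 T)
    (s' := fun s => (Finset.Icc s T).filter fun t => t ≤ s + m)]
  · refine Finset.sum_congr rfl fun s hs => ?_
    have hs' := Finset.mem_Icc.1 hs
    by_cases hc : conversion π ω s = true
    · simp only [hc, true_and]
      split_ifs with hd
      · rw [Finset.sum_eq_single (s + delay ω s)]
        · simp
        · intro t ht hne
          rw [if_neg]
          simp only [Finset.mem_filter, Finset.mem_Icc] at ht
          omega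
        · intro h
          exfalso
          apply h
          simp only [Finset.mem_filter, Finset.mem_Icc]
          omega
      · refine Finset.sum_eq_zero fun t ht => if_neg ?_
        simp only [Finset.mem_filter, Finset.mem_Icc] at ht
        omega
    · simp [hc]
  · intro t s
    simp only [Finset.mem_filter, Finset.mem_Icc]
    omega

lemma integral_disclosed (s j : ℕ) :
    ∫ ω, (if conversion π ω s = true ∧ delay ω s ≤ j then (1 : ℝ) else 0) ∂(sampleLaw ν δ θ) =
      delayCDF δ j * ∑ k, playProb ν δ θ π k s * θ k := by
  have hm : Measurable fun ω : Sample K Seed =>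
      if conversion π ω s = true ∧ delay ω s ≤ j then (1 : ℝ) else 0 := by
    have hd : Measurable fun q : Bool × ℕ => if q.1 = true ∧ q.2 ≤ j then (1 : ℝ) else 0 :=
      Measurable.of_discrete
    exact hd.comp ((measurable_conversion π s).prodMk (measurable_delay s))
  rw [integral_resample ν δ θ s hm (B := 1) fun ω => by split_ifs <;> simp]
  have h1 : ∀ ω : Sample K Seed, ∫ e, (if conversion π (resample ω s e) s = true ∧
      delay (resample ω s e) s ≤ j then (1 : ℝ) else 0) ∂(roundLaw δ θ) =
      delayCDF δ j * θ (action π ω s) := fun ω => by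
    have := integral_outcome δ θ (action π ω s) j fun b => if b ≤ j then (1 : ℝ) else 0
    simp only [outcome_le_iff le_rfl] at this
    simp only [conversion_resample_self, delay_resample_self]
    have hone : ∫ d in Set.Iic j, (if d ≤ j then (1 : ℝ) else 0) ∂δ = ∫ d in Set.Iic j, 1 ∂δ :=
      setIntegral_congr_fun measurableSet_Iic fun d hd => if_pos hd
    rw [this, hone]
    simp [delayCDF, mul_comm]
  simp only [h1]
  rw [integral_const_mul, integral_comp_action ν δ θ π (fun k => (θ k : ℝ))]

lemma expectedReward_eq (T : ℕ) :
    expectedReward ν δ θ π T = ∑ s ∈ Finset.Icc 1 T,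
      delayCDF δ (min m (T - s)) * ∑ k, playProb ν δ θ π k s * θ k := by
  simp only [expectedReward, sum_reward]
  rw [integral_finsetSum]
  · exact Finset.sum_congr rfl fun s _ => integral_disclosed ν δ θ π s _
  · intro s _
    have hd : Measurable fun q : Bool × ℕ =>
        if q.1 = true ∧ q.2 ≤ min m (T - s) then (1 : ℝ) else 0 := Measurable.of_discrete
    exact integrable_of_abs_le (B := 1)
      (hd.comp ((measurable_conversion π s).prodMk (measurable_delay s)))
      fun ω => by split_ifs <;> simp

lemma action_const (a : Fin K) (ω : Sample K Seed) (t : ℕ) :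
    action (Policy.const a : Policy K m Seed) ω t = a := by
  rw [action_eq]; rfl

lemma regret_eq (a : Fin K) (T : ℕ) :
    regret ν δ θ a π T = ∑ s ∈ Finset.Icc 1 T, delayCDF δ (min m (T - s)) *
      ∑ k, playProb ν δ θ π k s * ((θ a : ℝ) - θ k) := by
  rw [regret, expectedReward_eq, expectedReward_eq, ← Finset.sum_sub_distrib]
  refine Finset.sum_congr rfl fun s _ => ?_
  rw [← mul_sub]
  congr 1
  have h := integral_comp_action ν δ θ (Policy.const a : Policy K m Seed) (fun k => (θ k : ℝ)) s
  simp only [action_const, integral_const, probReal_univ, one_smul] at h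
  simp only [mul_sub, Finset.sum_sub_distrib]
  rw [← h, ← Finset.sum_mul, sum_playProb, one_mul]

/-- The rounds `s ≤ T` have disclosed their whole window at the horizon `T + m`, and each later
round contributes a nonnegative amount to the regret. -/
lemma le_regret {a : Fin K} (ha : ∀ k, θ k ≤ θ a) (T : ℕ) :
    delayCDF δ m * ∑ k, ((θ a : ℝ) - θ k) * meanPulls ν δ θ π k T ≤
      regret ν δ θ a π (T + m) := by
  have hgap : ∀ s, 0 ≤ ∑ k, playProb ν δ θ π k s * ((θ a : ℝ) - θ k) := fun s =>
    Finset.sum_nonneg fun k _ => mul_nonneg (playProb_nonneg ν δ θ π k s)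
      (sub_nonneg.2 (by exact_mod_cast ha k))
  have h1 : delayCDF δ m * ∑ k, ((θ a : ℝ) - θ k) * meanPulls ν δ θ π k T =
      ∑ s ∈ Finset.Icc 1 T, delayCDF δ (min m (T + m - s)) *
        ∑ k, playProb ν δ θ π k s * ((θ a : ℝ) - θ k) := by
    simp only [meanPulls, Finset.mul_sum]
    rw [Finset.sum_comm]
    refine Finset.sum_congr rfl fun s hs => Finset.sum_congr rfl fun k _ => ?_
    have := (Finset.mem_Icc.1 hs).2
    rw [min_eq_left (by omega)]
    ring
  rw [h1, regret_eq]
  exact Finset.sum_le_sum_of_subset_of_nonneg (Finset.Icc_subset_Icc_right (by omega))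
    fun s _ _ => mul_nonneg measureReal_nonneg (hgap s)

end Regret

/-! ### Change of measure -/

/-- The log-likelihood ratio of one observation of an arm, between the arm parameters `p` and `q`,
where `τ` is the probability that the delay is at most `m`. For `p = 0` the value at `b ≤ m` is
`log 0 = 0`, which is harmless because such an observation then has probability `0`. -/
noncomputable def logRatio (m : ℕ) (τ p q : ℝ) (b : ℕ) : ℝ :=
  if b ≤ m then Real.log (p / q) else Real.log ((1 - τ * p) / (1 - τ * q))

/-- The log-likelihood ratio of the observation of round `s` between `θ` and `θ'`, which differ
only in the parameter of the arm `k`. -/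
noncomputable def roundLogRatio (δ : Measure ℕ) (θ θ' : Fin K → unitInterval) (π : Policy K m Seed)
    (k : Fin K) (s : ℕ) (ω : Sample K Seed) : ℝ :=
  if action π ω s = k then logRatio m (delayCDF δ m) (θ k) (θ' k) (observation π ω s) else 0

/-- `F` is a function of the seed and of the observations of the rounds `1, …, T`. -/
def ObservedBy (π : Policy K m Seed) (T : ℕ) (F : Sample K Seed → ℝ) : Prop :=
  ∀ ω ω' : Sample K Seed, ω.1 = ω'.1 →
    (∀ s ∈ Finset.Icc 1 T, observation π ω s = observation π ω' s) → F ω = F ω'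

lemma delayCDF_le_one (δ : Measure ℕ) [IsProbabilityMeasure δ] (j : ℕ) : delayCDF δ j ≤ 1 :=
  measureReal_le_one

lemma delayCDF_nonneg (δ : Measure ℕ) (j : ℕ) : 0 ≤ delayCDF δ j := measureReal_nonneg

lemma one_sub_delayCDF_mul_pos (δ : Measure ℕ) [IsProbabilityMeasure δ] (j : ℕ)
    {p : unitInterval} (hp : p < 1) : 0 < 1 - delayCDF δ j * p := by
  have hp' : (p : ℝ) < 1 := by exact_mod_cast hp
  nlinarith [delayCDF_le_one δ j, delayCDF_nonneg δ j, p.2.1]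

section ChangeOfMeasure

variable {ν : Measure Seed} [IsProbabilityMeasure ν] {δ : Measure ℕ} [IsProbabilityMeasure δ]
  {θ θ' : Fin K → unitInterval} {k : Fin K} (π : Policy K m Seed)

/-- Change of measure for one round. There is only an inequality because the law under `θ'` need
not be absolutely continuous with respect to the law under `θ` if `θ k = 0`. -/
lemma integral_outcome_mul_exp_le (hθ : ∀ j, j ≠ k → θ' j = θ j) (hk : θ k < 1)
    (hk0 : 0 < θ' k) (hk1 : θ' k < 1) (a : Fin K) {f : ℕ → ℝ} (hf : ∀ b, 0 ≤ f b) :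
    ∫ e, f (outcome m (e.1 a) e.2) * Real.exp (-(if a = k then
        logRatio m (delayCDF δ m) (θ k) (θ' k) (outcome m (e.1 a) e.2) else 0)) ∂(roundLaw δ θ) ≤
      ∫ e, f (outcome m (e.1 a) e.2) ∂(roundLaw δ θ') := by
  rw [integral_outcome δ θ a m fun b => f b * Real.exp (-(if a = k then
        logRatio m (delayCDF δ m) (θ k) (θ' k) b else 0)), integral_outcome δ θ' a m f]
  by_cases hak : a = k
  · subst hak
    simp only [if_true]
    have hq : (0 : ℝ) < θ' a := by exact_mod_cast hk0
    have h1 : ∫ d in Set.Iic m, f d * Real.exp (-logRatio m (delayCDF δ m) (θ a) (θ' a) d) ∂δ =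
        (∫ d in Set.Iic m, f d ∂δ) * Real.exp (-Real.log ((θ a : ℝ) / θ' a)) := by
      rw [← integral_mul_const]
      refine setIntegral_congr_fun measurableSet_Iic fun d hd => ?_
      simp only [logRatio, if_pos (show d ≤ m from hd)]
    have h2 : logRatio m (delayCDF δ m) (θ a) (θ' a) (m + 1) =
        Real.log ((1 - delayCDF δ m * θ a) / (1 - delayCDF δ m * θ' a)) := by
      rw [logRatio, if_neg (by omega)]
    have hpos := one_sub_delayCDF_mul_pos δ m hk
    have hpos' := one_sub_delayCDF_mul_pos δ m hk1
    have hf0 : 0 ≤ ∫ d in Set.Iic m, f d ∂δ := integral_nonneg fun d => hf d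
    have h3 : (θ a : ℝ) * Real.exp (-Real.log ((θ a : ℝ) / θ' a)) ≤ θ' a := by
      rcases (θ a).2.1.eq_or_lt with h0 | h0
      · rw [← h0]; simp [hq.le]
      · rw [Real.exp_neg, Real.exp_log (div_pos h0 hq)]
        field_simp
        exact le_rfl
    rw [h1, h2, Real.exp_neg (Real.log (_ / (1 - _))), Real.exp_log (div_pos hpos hpos')]
    have h4 : (1 - delayCDF δ m * θ a) * (f (m + 1) *
        ((1 - delayCDF δ m * θ a) / (1 - delayCDF δ m * θ' a))⁻¹) =
        (1 - delayCDF δ m * θ' a) * f (m + 1) := by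
      field_simp
    rw [h4]
    have := mul_le_mul_of_nonneg_left h3 hf0
    linarith
  · simp [if_neg hak, hθ a hak]

omit [IsProbabilityMeasure δ] in
lemma measurable_roundLogRatio (s : ℕ) :
    Measurable fun ω : Sample K Seed => roundLogRatio δ θ θ' π k s ω := by
  have hd : Measurable fun q : Fin K × ℕ =>
      if q.1 = k then logRatio m (delayCDF δ m) (θ k) (θ' k) q.2 else 0 := Measurable.of_discrete
  exact hd.comp ((measurable_action π s).prodMk (measurable_observation π s))

lemma exists_abs_logRatio_le (m : ℕ) (τ p q : ℝ) : ∃ C, 0 ≤ C ∧ ∀ b, |logRatio m τ p q b| ≤ C := by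
  refine ⟨|Real.log (p / q)| + |Real.log ((1 - τ * p) / (1 - τ * q))|, by positivity, fun b => ?_⟩
  unfold logRatio
  split_ifs
  · linarith [abs_nonneg (Real.log ((1 - τ * p) / (1 - τ * q)))]
  · linarith [abs_nonneg (Real.log (p / q))]

lemma exists_abs_roundLogRatio_le (δ : Measure ℕ) (θ θ' : Fin K → unitInterval) (k : Fin K) :
    ∃ C, 0 ≤ C ∧ ∀ s ω, |roundLogRatio δ θ θ' π k s ω| ≤ C := by
  obtain ⟨C, hC0, hC⟩ := exists_abs_logRatio_le m (delayCDF δ m) (θ k) (θ' k)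
  refine ⟨C, hC0, fun s ω => ?_⟩
  unfold roundLogRatio
  split_ifs
  · exact hC _
  · simpa using hC0

lemma exists_abs_sum_roundLogRatio_le (δ : Measure ℕ) (θ θ' : Fin K → unitInterval) (k : Fin K)
    (T : ℕ) : ∃ C, ∀ ω, |∑ s ∈ Finset.Icc 1 T, roundLogRatio δ θ θ' π k s ω| ≤ C := by
  obtain ⟨C, -, hC⟩ := exists_abs_roundLogRatio_le π δ θ θ' k
  exact ⟨∑ s ∈ Finset.Icc 1 T, C, fun ω =>
    (Finset.abs_sum_le_sum_abs _ _).trans (Finset.sum_le_sum fun s _ => hC s ω)⟩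

omit [IsProbabilityMeasure δ] in
lemma observedBy_roundLogRatio {s T : ℕ} (hs : 1 ≤ s) (hsT : s ≤ T) :
    ObservedBy π T fun ω => roundLogRatio δ θ θ' π k s ω := by
  intro ω ω' h1 h
  have ha : action π ω s = action π ω' s := action_congr π h1 fun r hr =>
    h r (Finset.mem_Icc.2 ⟨(Finset.mem_Ico.1 hr).1, (Finset.mem_Ico.1 hr).2.le.trans hsT⟩)
  simp only [roundLogRatio, ha, h s (Finset.mem_Icc.2 ⟨hs, hsT⟩)]

/-- Two sample points with the same seed and the same observations up to round `T` choose the same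
arm at round `T + 1`, so they stay indistinguishable when that round is replaced by potential
outcomes that this arm turns into the same observation. -/
lemma ObservedBy.resample_eq {π : Policy K m Seed} {T : ℕ} {F : Sample K Seed → ℝ}
    (hF : ObservedBy π (T + 1) F) {ω ω' : Sample K Seed} (h1 : ω.1 = ω'.1)
    (h : ∀ s ∈ Finset.Icc 1 T, observation π ω s = observation π ω' s)
    {e e' : (Fin K → Bool) × ℕ}
    (he : outcome m (e.1 (action π ω (T + 1))) e.2 = outcome m (e'.1 (action π ω (T + 1))) e'.2) :
    F (resample ω (T + 1) e) = F (resample ω' (T + 1) e') := by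
  refine hF _ _ h1 fun s hs => ?_
  obtain ⟨hs1, hs2⟩ := Finset.mem_Icc.1 hs
  rcases hs2.eq_or_lt with rfl | hlt
  · have ha : action π ω (T + 1) = action π ω' (T + 1) := action_congr π h1 fun r hr =>
      h r (Finset.mem_Icc.2 ⟨(Finset.mem_Ico.1 hr).1, by
        have := (Finset.mem_Ico.1 hr).2; omega⟩)
    rw [observation_resample_self, observation_resample_self, he, ha]
  · rw [observation_resample_of_lt π ω e hlt, observation_resample_of_lt π ω' e' hlt,
      h s (Finset.mem_Icc.2 ⟨hs1, by omega⟩)]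

/-- Change of measure for the observations of the first `T` rounds. The induction step integrates
out the last round, which is independent of the past. -/
lemma integral_mul_exp_le (hθ : ∀ j, j ≠ k → θ' j = θ j) (hk : θ k < 1)
    (hk0 : 0 < θ' k) (hk1 : θ' k < 1) (T : ℕ) :
    ∀ F : Sample K Seed → ℝ, Measurable F → (∀ ω, 0 ≤ F ω) → (∃ B, ∀ ω, F ω ≤ B) →
      ObservedBy π T F →
      ∫ ω, F ω * Real.exp (-∑ s ∈ Finset.Icc 1 T, roundLogRatio δ θ θ' π k s ω)
          ∂(sampleLaw ν δ θ) ≤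
        ∫ ω, F ω ∂(sampleLaw ν δ θ') := by
  induction T with
  | zero =>
    intro F hF hF0 _ hobs
    have h1 : ∀ ω, F ω = F (ω.1, fun _ => (fun _ => false, 0)) := fun ω =>
      hobs _ _ rfl fun s hs => by simp at hs
    have h2 : ∀ θ₀ : Fin K → unitInterval, ∫ ω, F ω ∂(sampleLaw ν δ θ₀) =
        ∫ u, F (u, fun _ => (fun _ => false, 0)) ∂ν := fun θ₀ => by
      rw [integral_congr_ae (ae_of_all _ h1), sampleLaw_eq]
      exact (integral_fun_fst fun u => F (u, fun _ => (fun _ => false, 0))).trans (by simp)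
    simp [h2]
  | succ T ih =>
    rintro F hF hF0 ⟨B, hB⟩ hobs
    obtain ⟨C, hC0, hC⟩ := exists_abs_roundLogRatio_le π δ θ θ' k
    obtain ⟨C', hC'⟩ := exists_abs_sum_roundLogRatio_le π δ θ θ' k T
    have hFabs : ∀ ω, |F ω| ≤ B := fun ω => by rw [abs_of_nonneg (hF0 ω)]; exact hB ω
    have hBnn : ∀ _ω : Sample K Seed, 0 ≤ B := fun ω => (hF0 ω).trans (hB ω)
    set G : Sample K Seed → ℝ := fun ω => F ω * Real.exp (-roundLogRatio δ θ θ' π k (T + 1) ω)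
      with hG
    have hGm : Measurable G := hF.mul (measurable_roundLogRatio π (T + 1)).neg.exp
    have hG0 : ∀ ω, 0 ≤ G ω := fun ω => mul_nonneg (hF0 ω) (Real.exp_pos _).le
    have hGB : ∀ ω, G ω ≤ B * Real.exp C := fun ω =>
      mul_le_mul (hB ω) (Real.exp_le_exp.2 ((neg_le_abs _).trans (hC _ ω))) (Real.exp_pos _).le
        (hBnn ω)
    have hGobs : ObservedBy π (T + 1) G := fun ω ω' h1 h => by
      simp only [hG, hobs ω ω' h1 h,
        observedBy_roundLogRatio π (δ := δ) (θ := θ) (θ' := θ') (k := k) (Nat.succ_pos T) le_rfl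
          ω ω' h1 h]
    set H : Sample K Seed → ℝ := fun ω => ∫ e, G (resample ω (T + 1) e) ∂(roundLaw δ θ) with hH
    have hHm : Measurable H :=
      ((hGm.comp (measurable_resample (T + 1))).stronglyMeasurable.integral_prod_right').measurable
    have hH0 : ∀ ω, 0 ≤ H ω := fun ω => integral_nonneg fun e => hG0 _
    have hHB : ∀ ω, H ω ≤ B * Real.exp C := fun ω => by
      have := norm_integral_le_of_norm_le_const (μ := roundLaw δ θ)
        (f := fun e => G (resample ω (T + 1) e)) (C := B * Real.exp C)
        (ae_of_all _ fun e => by rw [Real.norm_of_nonneg (hG0 _)]; exact hGB _)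
      have h2 := (le_abs_self _).trans this
      simpa using h2
    have hHobs : ObservedBy π T H := fun ω ω' h1 h =>
      integral_congr_ae (ae_of_all _ fun e => hGobs.resample_eq h1 h rfl)
    -- the past factor of the likelihood ratio is not affected by resampling round `T + 1`
    have hstep : ∫ ω, F ω * Real.exp (-∑ s ∈ Finset.Icc 1 (T + 1), roundLogRatio δ θ θ' π k s ω)
        ∂(sampleLaw ν δ θ) =
        ∫ ω, H ω * Real.exp (-∑ s ∈ Finset.Icc 1 T, roundLogRatio δ θ θ' π k s ω)
        ∂(sampleLaw ν δ θ) := by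
      have hsplit : ∀ ω, F ω * Real.exp (-∑ s ∈ Finset.Icc 1 (T + 1),
          roundLogRatio δ θ θ' π k s ω) =
          G ω * Real.exp (-∑ s ∈ Finset.Icc 1 T, roundLogRatio δ θ θ' π k s ω) := fun ω => by
        rw [Finset.sum_Icc_succ_top (Nat.succ_pos T), neg_add, Real.exp_add, hG]
        ring
      simp only [hsplit]
      have hexpm : Measurable fun ω : Sample K Seed =>
          Real.exp (-∑ s ∈ Finset.Icc 1 T, roundLogRatio δ θ θ' π k s ω) :=
        (Finset.measurable_sum _ fun s _ => measurable_roundLogRatio π s).neg.exp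
      rw [integral_resample ν δ θ (T + 1)
        (Φ := fun ω => G ω * Real.exp (-∑ s ∈ Finset.Icc 1 T, roundLogRatio δ θ θ' π k s ω))
        (hGm.mul hexpm) (B := B * Real.exp C * Real.exp C')
        fun ω => ?_]
      · refine integral_congr_ae (ae_of_all _ fun ω => ?_)
        simp only [hH]
        rw [← integral_mul_const]
        refine integral_congr_ae (ae_of_all _ fun e => ?_)
        simp only
        congr 3
        refine Finset.sum_congr rfl fun s hs => ?_
        have hs2 : s < T + 1 := Nat.lt_succ_of_le (Finset.mem_Icc.1 hs).2
        simp only [roundLogRatio, action_resample π ω (T + 1) e s hs2.le,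
          observation_resample_of_lt π ω e hs2]
      · rw [abs_of_nonneg (mul_nonneg (hG0 ω) (Real.exp_pos _).le)]
        exact mul_le_mul (hGB ω) (Real.exp_le_exp.2 ((neg_le_abs _).trans (hC' ω)))
          (Real.exp_pos _).le (mul_nonneg (hBnn ω) (Real.exp_pos _).le)
    rw [hstep]
    refine (ih H hHm hH0 ⟨_, hHB⟩ hHobs).trans ?_
    rw [integral_resample ν δ θ' (T + 1) hF hFabs]
    refine integral_mono (integrable_of_abs_le hHm (B := B * Real.exp C) fun ω => ?_)
      (integrable_of_abs_le
        ((hF.comp (measurable_resample (T + 1))).stronglyMeasurable.integral_prod_right').measurable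
        (B := B) fun ω => ?_) fun ω => ?_
    · rw [abs_of_nonneg (hH0 ω)]; exact hHB ω
    · have := norm_integral_le_of_norm_le_const (μ := roundLaw δ θ')
        (f := fun e => F (resample ω (T + 1) e)) (ae_of_all _ fun e => hFabs _)
      simpa using this
    · -- as a function of the resampled round, `F` depends on the observation only
      have hfac : ∀ e, F (resample ω (T + 1) e) =
          F (resample ω (T + 1) (fun _ => decide (outcome m (e.1 (action π ω (T + 1))) e.2 ≤ m),
            outcome m (e.1 (action π ω (T + 1))) e.2)) := fun e => by
        refine hobs.resample_eq rfl (fun _ _ => rfl) ?_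
        have hle := outcome_le m (e.1 (action π ω (T + 1))) e.2
        generalize outcome m (e.1 (action π ω (T + 1))) e.2 = b at hle
        simp only [outcome, decide_eq_true_eq, and_self]
        split_ifs <;> omega
      have key := integral_outcome_mul_exp_le (m := m) (δ := δ) hθ hk hk0 hk1 (action π ω (T + 1))
        (f := fun b => F (resample ω (T + 1) (fun _ => decide (b ≤ m), b))) fun b => hF0 _
      simp only [← hfac] at key
      refine le_trans (le_of_eq ?_) key
      refine integral_congr_ae (ae_of_all _ fun e => ?_)
      simp only [hG, roundLogRatio, action_resample π ω (T + 1) e (T + 1) le_rfl,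
        observation_resample_self]

/-! ### The information inequality -/

/-- The inequality of Donsker and Varadhan for the observations of the first `T` rounds. -/
lemma integral_sub_le_log_integral_exp (hθ : ∀ j, j ≠ k → θ' j = θ j) (hk : θ k < 1)
    (hk0 : 0 < θ' k) (hk1 : θ' k < 1) (T : ℕ) {f : Sample K Seed → ℝ} (hf : Measurable f)
    {B : ℝ} (hB : ∀ ω, |f ω| ≤ B) (hobs : ObservedBy π T f) :
    ∫ ω, f ω ∂(sampleLaw ν δ θ) -
        ∫ ω, ∑ s ∈ Finset.Icc 1 T, roundLogRatio δ θ θ' π k s ω ∂(sampleLaw ν δ θ) ≤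
      Real.log (∫ ω, Real.exp (f ω) ∂(sampleLaw ν δ θ')) := by
  obtain ⟨C, hC⟩ := exists_abs_sum_roundLogRatio_le π δ θ θ' k T
  have hLm : Measurable fun ω : Sample K Seed =>
      ∑ s ∈ Finset.Icc 1 T, roundLogRatio δ θ θ' π k s ω :=
    Finset.measurable_sum _ fun s _ => measurable_roundLogRatio π s
  have hcm := integral_mul_exp_le (ν := ν) (δ := δ) π hθ hk hk0 hk1 T (fun ω => Real.exp (f ω))
    hf.exp (fun ω => (Real.exp_pos _).le)
    ⟨Real.exp B, fun ω => Real.exp_le_exp.2 ((le_abs_self _).trans (hB ω))⟩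
    fun ω ω' h1 h => by simp only [hobs ω ω' h1 h]
  have hfi : Integrable f (sampleLaw ν δ θ) := integrable_of_abs_le hf hB
  have hLi : Integrable (fun ω : Sample K Seed =>
      ∑ s ∈ Finset.Icc 1 T, roundLogRatio δ θ θ' π k s ω) (sampleLaw ν δ θ) :=
    integrable_of_abs_le hLm hC
  rw [← integral_sub hfi hLi]
  have hJ : Real.exp (∫ ω, (f ω - ∑ s ∈ Finset.Icc 1 T, roundLogRatio δ θ θ' π k s ω)
      ∂(sampleLaw ν δ θ)) ≤
      ∫ ω, Real.exp (f ω - ∑ s ∈ Finset.Icc 1 T, roundLogRatio δ θ θ' π k s ω)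
      ∂(sampleLaw ν δ θ) := by
    refine convexOn_exp.map_integral_le Real.continuous_exp.continuousOn isClosed_univ
      (ae_of_all _ fun _ => Set.mem_univ _) (hfi.sub hLi)
      (integrable_of_abs_le (hf.sub hLm).exp (B := Real.exp (B + C)) fun ω => ?_)
    rw [Function.comp_apply, abs_of_pos (Real.exp_pos _)]
    refine Real.exp_le_exp.2 ?_
    have h1 := abs_le.1 (hB ω)
    have h2 := abs_le.1 (hC ω)
    linarith
  simp only [← Real.exp_add, ← sub_eq_add_neg] at hcm
  exact (Real.le_log_iff_exp_le ((Real.exp_pos _).trans_le (hJ.trans hcm))).2 (hJ.trans hcm)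

lemma integral_sum_roundLogRatio (hτ : 0 < delayCDF δ m) (T : ℕ) :
    ∫ ω, ∑ s ∈ Finset.Icc 1 T, roundLogRatio δ θ θ' π k s ω ∂(sampleLaw ν δ θ) =
      meanPulls ν δ θ π k T * bernoulliKL (delayCDF δ m * θ k) (delayCDF δ m * θ' k) := by
  obtain ⟨C, hC0, hC⟩ := exists_abs_roundLogRatio_le π δ θ θ' k
  rw [integral_finsetSum _ fun s _ =>
    integrable_of_abs_le (measurable_roundLogRatio π s) (hC s), meanPulls, Finset.sum_mul]
  refine Finset.sum_congr rfl fun s _ => ?_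
  rw [integral_resample ν δ θ s (measurable_roundLogRatio π s) (hC s), ← integral_ite_action]
  refine integral_congr_ae (ae_of_all _ fun ω => ?_)
  simp only [roundLogRatio, action_resample π ω s _ s le_rfl, observation_resample_self]
  have hlog : ∫ d in Set.Iic m, logRatio m (delayCDF δ m) (θ k) (θ' k) d ∂δ =
      ∫ d in Set.Iic m, Real.log ((θ k : ℝ) / θ' k) ∂δ :=
    setIntegral_congr_fun measurableSet_Iic fun d hd => if_pos hd
  split_ifs with h
  · rw [h, integral_outcome δ θ k m (logRatio m (delayCDF δ m) (θ k) (θ' k)),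
      hlog, logRatio, if_neg (by omega), bernoulliKL,
      mul_div_mul_left _ _ hτ.ne', setIntegral_const, smul_eq_mul]
    simp only [delayCDF]
    ring
  · simp

/-- The information inequality: it bounds from below the number of pulls of `k` under `θ` if the
algorithm rarely plays an arm other than `k` under `θ'`. It is the inequality of Donsker and
Varadhan for `exp (a * W)`, where `W` is the proportion of rounds in which `k` is not played. -/
lemma information_inequality (hθ : ∀ j, j ≠ k → θ' j = θ j) (hk : θ k < 1)
    (hk0 : 0 < θ' k) (hk1 : θ' k < 1) (hτ : 0 < delayCDF δ m) {T : ℕ} (hT : 0 < T) (a : ℝ) :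
    a * (1 - meanPulls ν δ θ π k T / T) - meanPulls ν δ θ π k T *
        bernoulliKL (delayCDF δ m * θ k) (delayCDF δ m * θ' k) ≤
      Real.log (1 + (Real.exp a - 1) * (1 - meanPulls ν δ θ' π k T / T)) := by
  have hT' : (0 : ℝ) < T := by exact_mod_cast hT
  set W : Sample K Seed → ℝ := fun ω =>
    1 - (∑ s ∈ Finset.Icc 1 T, if action π ω s = k then (1 : ℝ) else 0) / T with hW
  have hWm : Measurable W := measurable_const.sub ((Finset.measurable_sum _ fun s _ =>
    Measurable.ite (measurable_action π s (measurableSet_singleton k))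
        measurable_const measurable_const).div_const _)
  have hN : ∀ ω : Sample K Seed,
      0 ≤ (∑ s ∈ Finset.Icc 1 T, if action π ω s = k then (1 : ℝ) else 0) ∧
      (∑ s ∈ Finset.Icc 1 T, if action π ω s = k then (1 : ℝ) else 0) ≤ T := fun ω => by
    refine ⟨Finset.sum_nonneg fun s _ => by split_ifs <;> simp, ?_⟩
    calc _ ≤ ∑ s ∈ Finset.Icc 1 T, (1 : ℝ) :=
          Finset.sum_le_sum fun s _ => by split_ifs <;> simp
      _ = T := by simp
  have hW0 : ∀ ω, 0 ≤ W ω := fun ω => by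
    simp only [hW, sub_nonneg]; exact (div_le_one hT').2 (hN ω).2
  have hW1 : ∀ ω, W ω ≤ 1 := fun ω => by
    simp only [hW]; linarith [div_nonneg (hN ω).1 hT'.le]
  have hWabs : ∀ ω, |W ω| ≤ 1 := fun ω => abs_le.2 ⟨by linarith [hW0 ω], hW1 ω⟩
  have hWobs : ObservedBy π T W := fun ω ω' h1 h => by
    simp only [hW]
    congr 2
    refine Finset.sum_congr rfl fun s hs => ?_
    rw [action_congr π h1 fun r hr => h r (Finset.mem_Icc.2 ⟨(Finset.mem_Ico.1 hr).1,
      (Finset.mem_Ico.1 hr).2.le.trans (Finset.mem_Icc.1 hs).2⟩)]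
  have hWint : ∀ θ₀ : Fin K → unitInterval, ∫ ω, W ω ∂(sampleLaw ν δ θ₀) =
      1 - meanPulls ν δ θ₀ π k T / T := fun θ₀ => by
    have hi : ∀ s ∈ Finset.Icc 1 T, Integrable (fun ω : Sample K Seed =>
        if action π ω s = k then (1 : ℝ) else 0) (sampleLaw ν δ θ₀) := fun s _ =>
      integrable_of_abs_le (B := 1) (Measurable.ite (measurable_action π s
        (measurableSet_singleton k)) measurable_const measurable_const)
        fun ω => by split_ifs <;> simp
    simp only [hW]
    rw [integral_sub (integrable_const _) ((integrable_finsetSum _ hi).div_const _),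
      integral_div, integral_finsetSum _ hi]
    simp [integral_ite_action, meanPulls]
  have hDV := integral_sub_le_log_integral_exp (ν := ν) (δ := δ) π hθ hk hk0 hk1 T
    (f := fun ω => a * W ω) (hWm.const_mul a) (B := |a|)
    (fun ω => by rw [abs_mul]; exact mul_le_of_le_one_right (abs_nonneg a) (hWabs ω))
    fun ω ω' h1 h => by simp only [hWobs ω ω' h1 h]
  rw [integral_const_mul, hWint, integral_sum_roundLogRatio π hτ] at hDV
  refine hDV.trans (Real.log_le_log ?_ ?_)
  · refine integral_exp_pos (integrable_of_abs_le (hWm.const_mul a).exp (B := Real.exp |a|)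
      fun ω => ?_)
    rw [abs_of_pos (Real.exp_pos _)]
    refine Real.exp_le_exp.2 ((le_abs_self _).trans ?_)
    rw [abs_mul]; exact mul_le_of_le_one_right (abs_nonneg a) (hWabs ω)
  · rw [← hWint θ']
    have hWi : Integrable W (sampleLaw ν δ θ') := integrable_of_abs_le hWm hWabs
    have : 1 + (Real.exp a - 1) * ∫ ω, W ω ∂(sampleLaw ν δ θ') =
        ∫ ω, (1 + (Real.exp a - 1) * W ω) ∂(sampleLaw ν δ θ') := by
      rw [integral_add (integrable_const _) (hWi.const_mul _), integral_const_mul]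
      simp
    rw [this]
    refine integral_mono_of_nonneg (ae_of_all _ fun ω => (Real.exp_pos _).le)
      ((integrable_const _).add (hWi.const_mul _)) (ae_of_all _ fun ω => ?_)
    -- the exponential is convex, so it lies below its chord on `[0, a]`
    have := convexOn_exp.2 (Set.mem_univ 0) (Set.mem_univ a) (sub_nonneg.2 (hW1 ω)) (hW0 ω)
      (by ring)
    simp only [smul_eq_mul, mul_zero, zero_add, Real.exp_zero, mul_one] at this
    simp only
    rw [mul_comm a]
    linarith

end ChangeOfMeasure

/-! ### Asymptotics under uniform efficiency -/

lemma tendsto_log_div_log_add (m : ℕ) :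
    Tendsto (fun T : ℕ => Real.log T / Real.log ((T + m : ℕ) : ℝ)) atTop (𝓝 1) := by
  have hlog : Tendsto (fun T : ℕ => Real.log ((T + m : ℕ) : ℝ)) atTop atTop :=
    Real.tendsto_log_atTop.comp
      (tendsto_natCast_atTop_atTop.comp (tendsto_add_atTop_nat m))
  have hratio : Tendsto (fun T : ℕ => 1 + (m : ℝ) / T) atTop (𝓝 (1 + 0)) :=
    tendsto_const_nhds.add (tendsto_const_div_atTop_nhds_zero_nat _)
  have h1 : Tendsto (fun T : ℕ => Real.log (1 + (m : ℝ) / T)) atTop (𝓝 0) := by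
    have := hratio.log (by norm_num)
    simpa using this
  have h2 : Tendsto (fun T : ℕ => 1 - Real.log (1 + (m : ℝ) / T) / Real.log ((T + m : ℕ) : ℝ))
      atTop (𝓝 (1 - 0)) := tendsto_const_nhds.sub (h1.div_atTop hlog)
  rw [sub_zero] at h2
  refine h2.congr' ?_
  filter_upwards [eventually_ge_atTop 2] with T hT
  have hT' : (0 : ℝ) < T := by exact_mod_cast (by omega : 0 < T)
  have hTm : (1 : ℝ) < ((T + m : ℕ) : ℝ) := by exact_mod_cast (by omega : 1 < T + m)
  have hpos := Real.log_pos hTm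
  have h3 : Real.log (1 + (m : ℝ) / T) = Real.log ((T + m : ℕ) : ℝ) - Real.log T := by
    rw [← Real.log_div (by positivity) hT'.ne']
    congr 1
    push_cast
    field_simp
  rw [h3]
  field_simp
  ring

section Efficient

variable {ν : Measure Seed} [IsProbabilityMeasure ν] {δ : Measure ℕ} [IsProbabilityMeasure δ]
  {π : Policy K m Seed}

omit [IsProbabilityMeasure ν] in
lemma UniformlyEfficient.tendsto_regret_add (hπ : UniformlyEfficient ν δ π)
    {θ : Fin K → unitInterval} {a : Fin K} (ha : ∀ k, θ k ≤ θ a) {α : ℝ} (hα0 : 0 < α)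
    (hα1 : α < 1) :
    Tendsto (fun T : ℕ => regret ν δ θ a π (T + m) / (T : ℝ) ^ α) atTop (𝓝 0) := by
  have h1 : Tendsto (fun T : ℕ => regret ν δ θ a π (T + m) / ((T + m : ℕ) : ℝ) ^ α)
      atTop (𝓝 0) := (hπ θ a ha α hα0 hα1).comp (tendsto_add_atTop_nat m)
  have h2 : Tendsto (fun T : ℕ => (1 + (m : ℝ) / T) ^ α) atTop (𝓝 ((1 + 0) ^ α)) :=
    (tendsto_const_nhds.add (tendsto_const_div_atTop_nhds_zero_nat _)).rpow_const
      (Or.inr hα0.le)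
  have h3 := h1.mul h2
  rw [zero_mul] at h3
  refine h3.congr' ?_
  filter_upwards [eventually_ge_atTop 1] with T hT
  have hT' : (0 : ℝ) < T := by exact_mod_cast hT
  have h4 : (1 + (m : ℝ) / T) = ((T + m : ℕ) : ℝ) / T := by push_cast; field_simp
  rw [h4, Real.div_rpow (by positivity) hT'.le]
  have : ((T + m : ℕ) : ℝ) ^ α ≠ 0 := (Real.rpow_pos_of_pos (by positivity) α).ne'
  field_simp

lemma UniformlyEfficient.tendsto_meanPulls (hπ : UniformlyEfficient ν δ π)
    (hτ : 0 < delayCDF δ m) {θ : Fin K → unitInterval} {a k : Fin K} (ha : ∀ k, θ k ≤ θ a)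
    (hk : θ k < θ a) {α : ℝ} (hα0 : 0 < α) (hα1 : α < 1) :
    Tendsto (fun T : ℕ => meanPulls ν δ θ π k T / (T : ℝ) ^ α) atTop (𝓝 0) := by
  have hgap : (0 : ℝ) < (θ a : ℝ) - θ k := sub_pos.2 (by exact_mod_cast hk)
  have h1 := (hπ.tendsto_regret_add ha hα0 hα1).const_mul
    (delayCDF δ m * ((θ a : ℝ) - θ k))⁻¹
  rw [mul_zero] at h1
  refine squeeze_zero (fun T => div_nonneg (meanPulls_nonneg ν δ θ π k T)
    (Real.rpow_nonneg (Nat.cast_nonneg T) α)) (fun T => ?_) h1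
  rw [← mul_div_assoc]
  refine div_le_div_of_nonneg_right ?_ (Real.rpow_nonneg (Nat.cast_nonneg T) α)
  rw [le_inv_mul_iff₀ (mul_pos hτ hgap)]
  refine le_trans ?_ (le_regret ν δ θ π ha T)
  rw [mul_assoc]
  refine mul_le_mul_of_nonneg_left ?_ hτ.le
  exact Finset.single_le_sum (f := fun j => ((θ a : ℝ) - θ j) * meanPulls ν δ θ π j T)
    (fun j _ => mul_nonneg (sub_nonneg.2 (by exact_mod_cast ha j)) (meanPulls_nonneg ν δ θ π j T))
    (Finset.mem_univ k)

lemma UniformlyEfficient.tendsto_sub_meanPulls (hπ : UniformlyEfficient ν δ π)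
    (hτ : 0 < delayCDF δ m) {θ : Fin K → unitInterval} {a : Fin K}
    (ha : ∀ k, k ≠ a → θ k < θ a) {α : ℝ} (hα0 : 0 < α) (hα1 : α < 1) :
    Tendsto (fun T : ℕ => (T - meanPulls ν δ θ π a T) / (T : ℝ) ^ α) atTop (𝓝 0) := by
  have ha' : ∀ k, θ k ≤ θ a := fun k => by
    rcases eq_or_ne k a with rfl | h
    · exact le_rfl
    · exact (ha k h).le
  have h1 := tendsto_finsetSum (Finset.univ.erase a) fun k hk =>
    hπ.tendsto_meanPulls hτ ha' (ha k (Finset.ne_of_mem_erase hk)) hα0 hα1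
  rw [Finset.sum_const_zero] at h1
  refine h1.congr fun T => ?_
  rw [← Finset.sum_div, ← sum_meanPulls ν δ θ π T,
    ← Finset.add_sum_erase _ _ (Finset.mem_univ a), add_sub_cancel_left]

/-- The divergence depends continuously on its second argument; if `p = 0` the term with `log 0`
vanishes identically. -/
lemma continuousAt_bernoulliKL {p q : ℝ} (hp : p < 1) (hq0 : 0 < q) (hq1 : q < 1) :
    ContinuousAt (fun q => bernoulliKL p q) q := by
  unfold bernoulliKL
  refine ContinuousAt.add ?_ ?_
  · rcases eq_or_ne p 0 with rfl | hp0
    · simpa using continuousAt_const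
    · exact continuousAt_const.mul ((continuousAt_const.div continuousAt_id hq0.ne').log
        (div_ne_zero hp0 hq0.ne'))
  · exact continuousAt_const.mul ((continuousAt_const.div (continuousAt_const.sub continuousAt_id)
      (sub_pos.2 hq1).ne').log (div_ne_zero (sub_pos.2 hp).ne' (sub_pos.2 hq1).ne'))

/-- The lower bound on the number of pulls of a suboptimal arm `k`. The information inequality is
applied to the model in which the parameter of `k` is raised to a value `l` slightly above the
optimum, with `exp a = 1 + T ^ β` for some `β < 1`; there, uniform efficiency makes the right-hand
side of the inequality tend to `0`. -/
lemma UniformlyEfficient.eventually_le_meanPulls (hπ : UniformlyEfficient ν δ π)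
    (hτ : 0 < delayCDF δ m) {θ : Fin K → unitInterval} {a k : Fin K}
    (ha : ∀ k, k ≠ a → θ k < θ a) (ha1 : θ a < 1) (hk : k ≠ a) {c : ℝ}
    (hc : c < 1 / bernoulliKL (delayCDF δ m * θ k) (delayCDF δ m * θ a)) :
    ∀ᶠ T : ℕ in atTop, c * Real.log ((T + m : ℕ) : ℝ) ≤ meanPulls ν δ θ π k T := by
  rcases le_or_gt c 0 with hc0 | hc0
  · refine Eventually.of_forall fun T => ?_
    exact (mul_nonpos_of_nonpos_of_nonneg hc0 (Real.log_natCast_nonneg _)).trans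
      (meanPulls_nonneg ν δ θ π k T)
  have hKL : 0 < bernoulliKL (delayCDF δ m * θ k) (delayCDF δ m * θ a) :=
    one_div_pos.1 (hc0.trans hc)
  have hka : (θ k : ℝ) < θ a := by exact_mod_cast ha k hk
  have hk0 : (0 : ℝ) ≤ θ k := (θ k).2.1
  have ha1' : (θ a : ℝ) < 1 := by exact_mod_cast ha1
  have hk1 : θ k < 1 := (ha k hk).trans ha1
  have hcont : ContinuousAt (fun x : ℝ => c * bernoulliKL (delayCDF δ m * θ k)
      (delayCDF δ m * x)) (θ a) := by
    have h1 := one_sub_delayCDF_mul_pos δ m hk1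
    have h2 := one_sub_delayCDF_mul_pos δ m ha1
    exact continuousAt_const.mul (ContinuousAt.comp' (g := fun q => bernoulliKL _ q)
      (continuousAt_bernoulliKL (by linarith) (mul_pos hτ (hk0.trans_lt hka)) (by linarith))
      (continuousAt_const.mul continuousAt_id))
  have hev : ∀ᶠ x in 𝓝[>] (θ a : ℝ),
      c * bernoulliKL (delayCDF δ m * θ k) (delayCDF δ m * x) < 1 :=
    (hcont.eventually (gt_mem_nhds ((lt_div_iff₀ hKL).1 hc))).filter_mono nhdsWithin_le_nhds
  obtain ⟨x, hx, hxa, hx1⟩ := (hev.and (Ioo_mem_nhdsGT ha1')).exists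
  set l : unitInterval := ⟨x, ((θ a).2.1.trans hxa.le), hx1.le⟩
  have hal : θ a < l := hxa
  have hl1 : l < 1 := hx1
  set θ' : Fin K → unitInterval := Function.update θ k l
  have hθ'k : θ' k = l := Function.update_self ..
  have hθ'j : ∀ j, j ≠ k → θ' j = θ j := fun j hj => Function.update_of_ne hj ..
  have hopt : ∀ j, j ≠ k → θ' j < θ' k := fun j hj => by
    rw [hθ'k, hθ'j j hj]
    rcases eq_or_ne j a with rfl | hja
    · exact hal
    · exact (ha j hja).trans hal
  have haleq : ∀ j, θ j ≤ θ a := fun j => by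
    rcases eq_or_ne j a with rfl | h
    · exact le_rfl
    · exact (ha j h).le
  set d := bernoulliKL (delayCDF δ m * θ k) (delayCDF δ m * θ' k) with hd
  have hcd : c * d < 1 := by rw [hd, hθ'k]; exact hx
  obtain ⟨β, hβ, hβ1⟩ := exists_between (max_lt hcd one_pos)
  have hβ0 : 0 < β := (le_max_right _ _).trans_lt hβ
  -- the two consequences of uniform efficiency, under `θ` and under `θ'`
  have hn : Tendsto (fun T : ℕ => meanPulls ν δ θ π k T / T) atTop (𝓝 0) := by
    refine squeeze_zero' (Eventually.of_forall fun T =>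
      div_nonneg (meanPulls_nonneg ν δ θ π k T) (Nat.cast_nonneg T)) ?_
      (hπ.tendsto_meanPulls hτ haleq (ha k hk) (α := 1 / 2) (by norm_num) (by norm_num))
    filter_upwards [eventually_ge_atTop 1] with T hT
    have hT' : (1 : ℝ) ≤ T := by exact_mod_cast hT
    refine div_le_div_of_nonneg_left (meanPulls_nonneg ν δ θ π k T)
      (Real.rpow_pos_of_pos (by linarith) _) ?_
    conv_rhs => rw [← Real.rpow_one (T : ℝ)]
    exact Real.rpow_le_rpow_of_exponent_le hT' (by norm_num)
  have hε := hπ.tendsto_sub_meanPulls hτ hopt (α := 1 - β) (by linarith) (by linarith)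
  have hlogε : Tendsto (fun T : ℕ => Real.log (1 + (T - meanPulls ν δ θ' π k T) /
      (T : ℝ) ^ (1 - β))) atTop (𝓝 0) := by
    have := (hε.const_add 1).log (by norm_num)
    simpa using this
  have hlogTop : Tendsto (fun T : ℕ => Real.log ((T + m : ℕ) : ℝ)) atTop atTop :=
    Real.tendsto_log_atTop.comp (tendsto_natCast_atTop_atTop.comp (tendsto_add_atTop_nat m))
  have hlim : Tendsto (fun T : ℕ => β * (Real.log T / Real.log ((T + m : ℕ) : ℝ)) *
      (1 - meanPulls ν δ θ π k T / T) - Real.log (1 + (T - meanPulls ν δ θ' π k T) /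
      (T : ℝ) ^ (1 - β)) / Real.log ((T + m : ℕ) : ℝ)) atTop (𝓝 (β * 1 * (1 - 0) - 0)) :=
    ((tendsto_const_nhds.mul (tendsto_log_div_log_add m)).mul (tendsto_const_nhds.sub hn)).sub
      (hlogε.div_atTop hlogTop)
  rw [show β * 1 * (1 - 0) - 0 = β by ring] at hlim
  filter_upwards [hlim.eventually (lt_mem_nhds hβ), eventually_ge_atTop 2] with T hT hT2
  have hT' : (0 : ℝ) < T := by exact_mod_cast (by omega : 0 < T)
  have hL : 0 < Real.log ((T + m : ℕ) : ℝ) :=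
    Real.log_pos (by exact_mod_cast (by omega : 1 < T + m))
  have hrpow : (0 : ℝ) < (T : ℝ) ^ β := Real.rpow_pos_of_pos hT' β
  have hinfo := information_inequality (ν := ν) π hθ'j hk1
    (hθ'k ▸ (θ a).2.1.trans_lt hal) (hθ'k ▸ hl1) hτ (by omega : 0 < T)
    (Real.log (1 + (T : ℝ) ^ β))
  rw [Real.exp_log (by positivity), add_sub_cancel_left, ← hd] at hinfo
  have hεeq : (T : ℝ) ^ β * (1 - meanPulls ν δ θ' π k T / T) =
      (T - meanPulls ν δ θ' π k T) / (T : ℝ) ^ (1 - β) := by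
    rw [Real.rpow_sub hT', Real.rpow_one]
    field_simp
  rw [hεeq] at hinfo
  have hfrac : 0 ≤ 1 - meanPulls ν δ θ π k T / T := by
    rw [sub_nonneg, div_le_one hT', ← sum_meanPulls ν δ θ π T]
    exact Finset.single_le_sum (fun j _ => meanPulls_nonneg ν δ θ π j T) (Finset.mem_univ k)
  have hlogβ : β * Real.log T ≤ Real.log (1 + (T : ℝ) ^ β) := by
    rw [← Real.log_rpow hT']
    exact Real.log_le_log hrpow (by linarith)
  have hmain : β * Real.log T * (1 - meanPulls ν δ θ π k T / T) -
      Real.log (1 + (T - meanPulls ν δ θ' π k T) / (T : ℝ) ^ (1 - β)) ≤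
      meanPulls ν δ θ π k T * d := by
    have := mul_le_mul_of_nonneg_right hlogβ hfrac
    linarith
  have hgrow : max (c * d) 0 * Real.log ((T + m : ℕ) : ℝ) <
      β * Real.log T * (1 - meanPulls ν δ θ π k T / T) -
      Real.log (1 + (T - meanPulls ν δ θ' π k T) / (T : ℝ) ^ (1 - β)) := by
    rw [← lt_div_iff₀ hL]
    refine hT.trans_le (le_of_eq ?_)
    ring
  have hpos : 0 < meanPulls ν δ θ π k T * d :=
    ((mul_nonneg (le_max_right _ _) hL.le).trans_lt hgrow).trans_le hmain
  have hd0 : 0 < d := lt_of_not_ge fun h => hpos.not_ge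
    (mul_nonpos_of_nonneg_of_nonpos (meanPulls_nonneg ν δ θ π k T) h)
  have h5 : c * d * Real.log ((T + m : ℕ) : ℝ) ≤ max (c * d) 0 * Real.log ((T + m : ℕ) : ℝ) :=
    mul_le_mul_of_nonneg_right (le_max_left _ _) hL.le
  refine le_of_mul_le_mul_right ?_ hd0
  linarith

end Efficient

end CensoredBandit

open CensoredBandit

/-! ### The lower bound on the regret -/

theorem mainTheorem1 {K : ℕ} (m : ℕ)
    (δ : Measure ℕ) [IsProbabilityMeasure δ] (hτ : 0 < CensoredBandit.delayCDF δ m)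
    {Seed : Type*} [MeasurableSpace Seed] (ν : Measure Seed) [IsProbabilityMeasure ν]
    (π : CensoredBandit.Policy K m Seed)
    (hπ : CensoredBandit.UniformlyEfficient ν δ π)
    (θ : Fin K → unitInterval) (kstar : Fin K)
    (hunique : ∀ k, k ≠ kstar → θ k < θ kstar) (hlt : θ kstar < 1) :
    ((∑ k ∈ Finset.univ.erase kstar,
        CensoredBandit.delayCDF δ m * ((θ kstar : ℝ) - (θ k : ℝ)) /
          CensoredBandit.bernoulliKL (CensoredBandit.delayCDF δ m * (θ k : ℝ))
            (CensoredBandit.delayCDF δ m * (θ kstar : ℝ)) : ℝ) : EReal) ≤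
      liminf (fun T : ℕ =>
        ((CensoredBandit.regret ν δ θ kstar π T / Real.log (T : ℝ) : ℝ) : EReal)) atTop := by
  have hle : ∀ k, θ k ≤ θ kstar := fun k => by
    rcases eq_or_ne k kstar with rfl | h
    · exact le_rfl
    · exact (hunique k h).le
  have hgap : ∀ k, 0 ≤ (θ kstar : ℝ) - θ k := fun k => sub_nonneg.2 (by exact_mod_cast hle k)
  refine EReal.ge_of_forall_gt_iff_ge.1 fun z hz => le_liminf_of_le (by isBoundedDefault) ?_
  rw [EReal.coe_lt_coe_iff] at hz
  set S := ∑ k ∈ Finset.univ.erase kstar, delayCDF δ m * ((θ kstar : ℝ) - (θ k : ℝ)) /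
    bernoulliKL (delayCDF δ m * (θ k : ℝ)) (delayCDF δ m * (θ kstar : ℝ)) with hS
  set C := ∑ k ∈ Finset.univ.erase kstar, delayCDF δ m * ((θ kstar : ℝ) - (θ k : ℝ)) with hC
  have hC0 : 0 ≤ C := Finset.sum_nonneg fun k _ => mul_nonneg hτ.le (hgap k)
  -- lowering each constant `1 / d` by `ε` lowers the sum by `ε * C ≤ S - z`
  obtain ⟨ε, hε, hεC⟩ : ∃ ε : ℝ, 0 < ε ∧ z ≤ S - ε * C := by
    refine ⟨(S - z) / (C + 1), div_pos (sub_pos.2 hz) (by linarith), ?_⟩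
    have : (S - z) / (C + 1) * C ≤ S - z := by
      rw [div_mul_eq_mul_div, div_le_iff₀ (by linarith)]
      nlinarith
    linarith
  have hev : ∀ᶠ T : ℕ in atTop, ∀ k ∈ Finset.univ.erase kstar,
      (1 / bernoulliKL (delayCDF δ m * θ k) (delayCDF δ m * θ kstar) - ε) *
        Real.log ((T + m : ℕ) : ℝ) ≤ meanPulls ν δ θ π k T :=
    (Filter.eventually_all_finset _).2 fun k hk =>
      hπ.eventually_le_meanPulls hτ hunique hlt (Finset.ne_of_mem_erase hk) (by linarith)
  have hev' : ∀ᶠ T : ℕ in atTop, z * Real.log ((T + m : ℕ) : ℝ) ≤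
      regret ν δ θ kstar π (T + m) := by
    filter_upwards [hev] with T hT
    have hL : 0 ≤ Real.log ((T + m : ℕ) : ℝ) := Real.log_natCast_nonneg _
    calc z * Real.log ((T + m : ℕ) : ℝ)
        ≤ (S - ε * C) * Real.log ((T + m : ℕ) : ℝ) := mul_le_mul_of_nonneg_right hεC hL
      _ = ∑ k ∈ Finset.univ.erase kstar, delayCDF δ m * ((θ kstar : ℝ) - θ k) *
            ((1 / bernoulliKL (delayCDF δ m * θ k) (delayCDF δ m * θ kstar) - ε) *
              Real.log ((T + m : ℕ) : ℝ)) := by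
          rw [hS, hC, Finset.mul_sum, ← Finset.sum_sub_distrib, Finset.sum_mul]
          refine Finset.sum_congr rfl fun k _ => ?_
          ring
      _ ≤ ∑ k ∈ Finset.univ.erase kstar, delayCDF δ m * ((θ kstar : ℝ) - θ k) *
            meanPulls ν δ θ π k T :=
          Finset.sum_le_sum fun k hk =>
            mul_le_mul_of_nonneg_left (hT k hk) (mul_nonneg hτ.le (hgap k))
      _ = delayCDF δ m * ∑ k, ((θ kstar : ℝ) - θ k) * meanPulls ν δ θ π k T := by
          rw [← Finset.add_sum_erase _ _ (Finset.mem_univ kstar), sub_self, zero_mul, zero_add,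
            Finset.mul_sum]
          exact Finset.sum_congr rfl fun k _ => mul_assoc _ _ _
      _ ≤ regret ν δ θ kstar π (T + m) := le_regret ν δ θ π hle T
  obtain ⟨N, hN⟩ := eventually_atTop.1 hev'
  filter_upwards [eventually_ge_atTop (N + m + 2)] with T hT
  have h1 := hN (T - m) (by omega)
  rw [Nat.sub_add_cancel (by omega : m ≤ T)] at h1
  rw [EReal.coe_le_coe_iff, le_div_iff₀ (Real.log_pos (by exact_mod_cast (by omega : 1 < T)))]
  exact h1
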